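/- An $n$-bit gate is a unitary operator on $(\mathbb C^2)^{\otimes n}$, whose standard orthonormal basis consists of the vectors $|x_1x_2\cdots x_n\rangle$, $x_i\in\{0,1\}$. For a 1-bit gate $A$ and a slot $j$, let $A(j)$ be the $n$-bit gate acting as $A$ on the $j$-th qubit and trivially on the others; for a 2-bit gate $B$ and two distinct slots $j,k$, let $B(j,k)$ be the $n$-bit gate acting as $B$ on the $j$-th and $k$-th qubits (in this order) and trivially on the others. A collection of 1-bit gates $A_i$ and 2-bit gates $B_j$ is called (exactly) universal if, for each $n\ge 2$, every $n$-bit gate is equal, up to a global phase factor $c\in\mathbb C$, $|c|=1$, to a finite composition of gates $A_i(\ell)$ and $B_j(\ell,m)$ with $1\le \ell,m\le n$, $\ell\ne m$. Let $$U_{\theta,\phi}=\begin{pmatrix}\cos\theta & -ie^{-i\phi}\sin\theta\\ -ie^{i\phi}\sin\theta & \cos\theta\end{pmatrix},$$ and let the CNOT gate $\Lambda_1(\sigma_x)$ be the 2-bit gate with $|0y\rangle\mapsto|0y\rangle$ and $|1y\rangle\mapsto|1\rangle\otimes\sigma_x|y\rangle$, where $\sigma_x=\begin{pmatrix}0&1\\1&0\end{pmatrix}$.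 **Corollary 2.3.** The collection of all the 1-bit gates $U_{\theta,\phi}$, $0\le\theta,\phi\le 2\pi$, together with the CNOT gate $\Lambda_1(\sigma_x)$, is universal. Moreover, for each $n\ge 2$, every $n$-bit gate of determinant $1$ is equal to such a finite composition with no phase factor. -/

import Mathlib

/-- A 1-bit gate: a unitary operator on one qubit, written in the basis `|0⟩, |1⟩`. -/
abbrev OneBitGate : Type := Matrix.unitaryGroup (Fin 2) ℂ

/-- A 2-bit gate: a unitary operator on two qubits, written in the basis `|x₁x₂⟩`. -/
abbrev TwoBitGate : Type := Matrix.unitaryGroup (Fin 2 × Fin 2) ℂ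

/-- An operator on `n` qubits, written in the basis `|x₁x₂⋯xₙ⟩` of `(ℂ²)^{⊗n}`, which is indexed by
the bit strings `x : Fin n → Fin 2`. Slots are numbered `0, …, n - 1`. -/
abbrev QubitOperator (n : ℕ) : Type := Matrix (Fin n → Fin 2) (Fin n → Fin 2) ℂ

/-- `A(j)`: the 1-bit gate `A` acting on slot `j` of `n` qubits, and trivially on the others. -/
def OneBitGate.onSlot {n : ℕ} (A : OneBitGate) (j : Fin n) : QubitOperator n :=
  Matrix.of fun x y =>
    if ∀ i, i ≠ j → x i = y i then (A : Matrix (Fin 2) (Fin 2) ℂ) (x j) (y j) else 0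

/-- `B(j,k)`: the 2-bit gate `B` acting on the (distinct) slots `j` and `k` of `n` qubits, with `j`
as its first qubit and `k` as its second one, and trivially on the others. -/
def TwoBitGate.onSlots {n : ℕ} (B : TwoBitGate) (j k : Fin n) : QubitOperator n :=
  Matrix.of fun x y =>
    if ∀ i, i ≠ j → i ≠ k → x i = y i then
      (B : Matrix (Fin 2 × Fin 2) (Fin 2 × Fin 2) ℂ) (x j, x k) (y j, y k) else 0

/-- The operators `A(j)` and `B(j,k)` on `n` qubits, for `A` in the collection `S` of 1-bit gates,
`B` in the collection `T` of 2-bit gates, and all slots `j` and all pairs of distinct slots. -/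
def elementaryOperators (S : Set OneBitGate) (T : Set TwoBitGate) (n : ℕ) :
    Set (QubitOperator n) :=
  {M | (∃ A ∈ S, ∃ j : Fin n, M = A.onSlot j) ∨
       (∃ B ∈ T, ∃ j k : Fin n, j ≠ k ∧ M = TwoBitGate.onSlots B j k)}

/-- The operators on `n` qubits obtained by composing finitely many elementary ones. -/
def composedOperators (S : Set OneBitGate) (T : Set TwoBitGate) (n : ℕ) :
    Submonoid (QubitOperator n) :=
  Submonoid.closure (elementaryOperators S T n)

/-- Exact universality of a collection of 1-bit gates `S` and 2-bit gates `T`: for each `n ≥ 2`,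
every `n`-bit gate equals, up to a global phase factor, a finite composition of gates `A(j)` and
`B(j,k)`. -/
def IsUniversalGateSet (S : Set OneBitGate) (T : Set TwoBitGate) : Prop :=
  ∀ n : ℕ, 2 ≤ n → ∀ V ∈ Matrix.unitaryGroup (Fin n → Fin 2) ℂ,
    ∃ c : ℂ, ‖c‖ = 1 ∧ c • V ∈ composedOperators S T n

/-- The matrix of the rotation gate `U_{θ,φ}`. -/
noncomputable def rotationMatrix (θ φ : ℝ) : Matrix (Fin 2) (Fin 2) ℂ :=
  !![(Real.cos θ : ℂ), -Complex.I * Complex.exp (-Complex.I * φ) * (Real.sin θ : ℂ);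
     -Complex.I * Complex.exp (Complex.I * φ) * (Real.sin θ : ℂ), (Real.cos θ : ℂ)]

theorem rotationMatrix_mem (θ φ : ℝ) :
    rotationMatrix θ φ ∈ Matrix.unitaryGroup (Fin 2) ℂ := by
  have h1 : Complex.exp (Complex.I * φ) * Complex.exp (-(Complex.I * φ)) = 1 := by
    rw [← Complex.exp_add]; simp
  have h2 : Complex.cos θ ^ 2 + Complex.sin θ ^ 2 = 1 := Complex.cos_sq_add_sin_sq _
  have h3 : (starRingEnd ℂ) (Complex.exp (Complex.I * φ)) = Complex.exp (-(Complex.I * φ)) := by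
    rw [← Complex.exp_conj]; simp
  have h4 : (starRingEnd ℂ) (Complex.exp (-(Complex.I * φ))) = Complex.exp (Complex.I * φ) := by
    rw [← Complex.exp_conj]; simp
  have hc : (starRingEnd ℂ) (Complex.cos θ) = Complex.cos θ := by
    rw [← Complex.cos_conj]; simp
  have hs : (starRingEnd ℂ) (Complex.sin θ) = Complex.sin θ := by
    rw [← Complex.sin_conj]; simp
  rw [Matrix.mem_unitaryGroup_iff]
  ext i j
  fin_cases i <;> fin_cases j <;>
    simp [rotationMatrix, Matrix.mul_apply, Fin.sum_univ_two, h3, h4, hc, hs] <;>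
    grind [Complex.I_sq]

/-- The rotation gate `U_{θ,φ}`. -/
noncomputable def rotationGate (θ φ : ℝ) : OneBitGate := ⟨rotationMatrix θ φ, rotationMatrix_mem θ φ⟩

/-- The NOT gate `σ_x`. -/
def pauliX : Matrix (Fin 2) (Fin 2) ℂ := !![0, 1; 1, 0]

/-- The matrix of `Λ₁(U)`, the controlled-`U` operation: `|0y⟩ ↦ |0y⟩` and
`|1y⟩ ↦ u_{0y}|10⟩ + u_{1y}|11⟩`. The first qubit is the control, the second the target. -/
def controlledMatrix (U : Matrix (Fin 2) (Fin 2) ℂ) :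
    Matrix (Fin 2 × Fin 2) (Fin 2 × Fin 2) ℂ :=
  Matrix.of fun p q =>
    if p.1 = q.1 then (if q.1 = 1 then U p.2 q.2 else if p.2 = q.2 then 1 else 0) else 0

theorem controlledMatrix_pauliX_mem :
    controlledMatrix pauliX ∈ Matrix.unitaryGroup (Fin 2 × Fin 2) ℂ := by
  rw [Matrix.mem_unitaryGroup_iff]
  ext ⟨a, b⟩ ⟨c, d⟩
  fin_cases a <;> fin_cases b <;> fin_cases c <;> fin_cases d <;>
    simp [controlledMatrix, pauliX, Matrix.mul_apply, Fintype.sum_prod_type, Fin.sum_univ_two]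

/-- The controlled-not gate `Λ₁(σ_x)`. -/
def cnotGate : TwoBitGate := ⟨controlledMatrix pauliX, controlledMatrix_pauliX_mem⟩

/-- The collection of all rotation gates `U_{θ,φ}` with `0 ≤ θ, φ ≤ 2π`. -/
noncomputable def rotationGates : Set OneBitGate :=
  {A | ∃ θ ∈ Set.Icc (0 : ℝ) (2 * Real.pi), ∃ φ ∈ Set.Icc (0 : ℝ) (2 * Real.pi),
    A = rotationGate θ φ}

/-
Conjugating `σ_x` by a diagonal element of `SU(2)` and multiplying by `σ_x` produces every diagonal
element, so CNOT and `SU(2)` on single slots give, after diagonalization, every controlled special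
unitary. A commutator of operators controlled by two conditions is controlled by their conjunction;
since every element of `SU(2)` is a commutator, one more control costs nothing, and with all the
other slots as controls we get `SU(2)` acting on any two basis vectors that differ in one bit.
Conjugation by such operators along a path of bit flips extends this to any two basis vectors.
Finally, elimination of one coordinate after another writes every element of `SU(2ⁿ)` as a product
of such two-level unitaries. The rotation gates generate `SU(2)`, and a gate of arbitrary
determinant is moved into `SU(2ⁿ)` by a root of its determinant.
-/

open Matrix ComplexConjugate

theorem star_mem_specialUnitaryGroup {ι R : Type*} [Fintype ι] [DecidableEq ι] [CommRing R]
    [StarRing R] {W : Matrix ι ι R} (hW : W ∈ specialUnitaryGroup ι R) :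
    star W ∈ specialUnitaryGroup ι R :=
  (star (⟨W, hW⟩ : specialUnitaryGroup ι R)).2

theorem mul_conj_eq_one {u : ℂ} (hu : ‖u‖ = 1) : u * conj u = 1 := by
  simp [Complex.mul_conj, Complex.normSq_eq_norm_sq, hu]

theorem exists_smul_mem_specialUnitaryGroup {ι : Type*} [Fintype ι] [DecidableEq ι] [Nonempty ι]
    {V : Matrix ι ι ℂ} (hV : V ∈ unitaryGroup ι ℂ) :
    ∃ c : ℂ, ‖c‖ = 1 ∧ c • V ∈ specialUnitaryGroup ι ℂ := by
  have hdet : ‖V.det‖ = 1 := CStarRing.norm_of_mem_unitary (det_of_mem_unitary hV)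
  obtain ⟨c, hc⟩ := IsAlgClosed.exists_pow_nat_eq V.det⁻¹ (Fintype.card_pos (α := ι))
  have hcnorm : ‖c‖ = 1 := by
    refine (pow_eq_one_iff_of_nonneg (norm_nonneg c) (Fintype.card_ne_zero (α := ι))).1 ?_
    rw [← norm_pow, hc, norm_inv, hdet, inv_one]
  refine ⟨c, hcnorm, mem_specialUnitaryGroup_iff.2 ⟨?_, ?_⟩⟩
  · rw [mem_unitaryGroup_iff, star_smul, smul_mul_smul_comm, mem_unitaryGroup_iff.1 hV,
      ← starRingEnd_apply, mul_conj_eq_one hcnorm, one_smul]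
  · rw [det_smul, hc, inv_mul_cancel₀ (norm_ne_zero_iff.1 (by simp [hdet]))]

section SpecialUnitaryTwo

/-- The matrix `(α, -β̄; β, ᾱ)`, the general element of `SU(2)` when `|α|² + |β|² = 1`. -/
def su2 (α β : ℂ) : Matrix (Fin 2) (Fin 2) ℂ := !![α, -conj β; β, conj α]

theorem su2_mul (α β γ δ : ℂ) :
    su2 α β * su2 γ δ = su2 (α * γ - conj β * δ) (β * γ + conj α * δ) := by
  simp only [su2, mul_fin_two, map_add, map_sub, map_mul, Complex.conj_conj]
  ring_nf

theorem su2_mulVec (α β : ℂ) (v : Fin 2 → ℂ) :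
    su2 α β *ᵥ v = ![α * v 0 - conj β * v 1, β * v 0 + conj α * v 1] := by
  ext k
  fin_cases k <;> simp [su2, mulVec, dotProduct, sub_eq_add_neg]

theorem star_su2 (α β : ℂ) : star (su2 α β) = su2 (conj α) (-β) := by
  ext i j
  fin_cases i <;> fin_cases j <;> simp [su2]

theorem det_su2 (α β : ℂ) : (su2 α β).det = (‖α‖ ^ 2 + ‖β‖ ^ 2 : ℝ) := by
  simp [su2, ← Complex.normSq_eq_norm_sq, ← Complex.mul_conj, mul_comm]

theorem su2_mem_specialUnitaryGroup {α β : ℂ} (h : ‖α‖ ^ 2 + ‖β‖ ^ 2 = 1) :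
    su2 α β ∈ specialUnitaryGroup (Fin 2) ℂ := by
  have hdet : (su2 α β).det = 1 := by rw [det_su2, h, Complex.ofReal_one]
  have hstar : star (su2 α β) = (su2 α β).adjugate := by
    ext i j
    fin_cases i <;> fin_cases j <;> simp [su2, adjugate_fin_two]
  exact mem_specialUnitaryGroup_iff.2
    ⟨by rw [mem_unitaryGroup_iff, hstar, mul_adjugate, hdet, one_smul], hdet⟩

theorem mem_specialUnitaryGroup_fin_two_iff {W : Matrix (Fin 2) (Fin 2) ℂ} :
    W ∈ specialUnitaryGroup (Fin 2) ℂ ↔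
      ∃ α β : ℂ, ‖α‖ ^ 2 + ‖β‖ ^ 2 = 1 ∧ W = su2 α β := by
  refine ⟨fun hW => ?_, by rintro ⟨α, β, h, rfl⟩; exact su2_mem_specialUnitaryGroup h⟩
  have hdet : W.det = 1 := (mem_specialUnitaryGroup_iff.1 hW).2
  have hstar : star W = W.adjugate := by
    calc star W = star W * (W * W.adjugate) := by rw [mul_adjugate, hdet, one_smul, mul_one]
      _ = W.adjugate := by rw [← mul_assoc, Unitary.star_mul_self_of_mem hW.1, one_mul]
  have hEq : W = su2 (W 0 0) (W 1 0) := by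
    rw [adjugate_fin_two] at hstar
    have h00 : conj (W 0 0) = W 1 1 := by simpa using congrFun₂ hstar 0 0
    have h01 : conj (W 1 0) = -W 0 1 := by simpa using congrFun₂ hstar 0 1
    ext i j
    fin_cases i <;> fin_cases j <;> simp [su2, h00, h01]
  refine ⟨W 0 0, W 1 0, ?_, hEq⟩
  rw [hEq, det_su2] at hdet
  exact_mod_cast hdet

theorem su2_zero_one_mem_specialUnitaryGroup : su2 0 1 ∈ specialUnitaryGroup (Fin 2) ℂ :=
  su2_mem_specialUnitaryGroup (by simp)

theorem su2_zero_mem_specialUnitaryGroup {u : ℂ} (hu : ‖u‖ = 1) :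
    su2 u 0 ∈ specialUnitaryGroup (Fin 2) ℂ :=
  su2_mem_specialUnitaryGroup (by simp [hu])

theorem exists_specialUnitaryGroup_mulVec_eq_single (v : Fin 2 → ℂ) :
    ∃ W ∈ specialUnitaryGroup (Fin 2) ℂ, ∃ r : ℝ, 0 ≤ r ∧ W *ᵥ v = Pi.single 0 (r : ℂ) := by
  set r : ℝ := √(‖v 0‖ ^ 2 + ‖v 1‖ ^ 2)
  have hr : r ^ 2 = ‖v 0‖ ^ 2 + ‖v 1‖ ^ 2 := Real.sq_sqrt (by positivity)
  rcases eq_or_ne r 0 with h0 | h0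
  · have hv0 : v 0 = 0 := norm_eq_zero.1 (by nlinarith [sq_nonneg ‖v 0‖, sq_nonneg ‖v 1‖])
    have hv1 : v 1 = 0 := norm_eq_zero.1 (by nlinarith [sq_nonneg ‖v 0‖, sq_nonneg ‖v 1‖])
    have hv : v = 0 := by ext k; fin_cases k <;> assumption
    exact ⟨1, one_mem _, 0, le_rfl, by simp [hv]⟩
  · have hr0 : (r : ℂ) ≠ 0 := by exact_mod_cast h0
    have hsq : v 0 * conj (v 0) + v 1 * conj (v 1) = (r : ℂ) ^ 2 := by
      rw [Complex.mul_conj, Complex.mul_conj, Complex.normSq_eq_norm_sq,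
        Complex.normSq_eq_norm_sq]
      exact_mod_cast hr.symm
    refine ⟨su2 (conj (v 0) / r) (-v 1 / r), su2_mem_specialUnitaryGroup ?_, r,
      Real.sqrt_nonneg _, ?_⟩
    · simp only [norm_div, norm_neg, RCLike.norm_conj, Complex.norm_real, Real.norm_eq_abs,
        div_pow, sq_abs]
      field_simp
      exact hr.symm
    · have h0 : conj (v 0) / r * v 0 - conj (-v 1 / r) * v 1 = r := by
        rw [map_div₀, map_neg, Complex.conj_ofReal]
        field_simp
        linear_combination hsq
      have h1 : -v 1 / r * v 0 + conj (conj (v 0) / r) * v 1 = 0 := by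
        rw [map_div₀, Complex.conj_conj, Complex.conj_ofReal]
        ring
      rw [su2_mulVec, h0, h1]
      ext k
      fin_cases k <;> rfl

theorem exists_eigenvector (W : Matrix (Fin 2) (Fin 2) ℂ) :
    ∃ (u : ℂ) (v : Fin 2 → ℂ), v ≠ 0 ∧ W *ᵥ v = u • v := by
  obtain ⟨u, hu⟩ := Module.End.exists_eigenvalue (toLin' W)
  obtain ⟨v, hv⟩ := hu.exists_hasEigenvector
  exact ⟨u, v, hv.2, hv.apply_eq_smul⟩

theorem exists_specialUnitaryGroup_conj_diagonal {W : Matrix (Fin 2) (Fin 2) ℂ}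
    (hW : W ∈ specialUnitaryGroup (Fin 2) ℂ) :
    ∃ V ∈ specialUnitaryGroup (Fin 2) ℂ, ∃ v : ℂ, ‖v‖ = 1 ∧ W = V * su2 (v * v) 0 * star V := by
  obtain ⟨u, x, hx0, hx⟩ := exists_eigenvector W
  obtain ⟨V, hV, r, -, hVx⟩ := exists_specialUnitaryGroup_mulVec_eq_single x
  have hVV : star V * V = 1 := Unitary.star_mul_self_of_mem hV.1
  have hxV : x = star V *ᵥ Pi.single 0 (r : ℂ) := by rw [← hVx, mulVec_mulVec, hVV, one_mulVec]
  have hr : (r : ℂ) ≠ 0 := by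
    intro hr
    simp [hr, hx0] at hxV
  obtain ⟨α, β, h, hD⟩ := mem_specialUnitaryGroup_fin_two_iff.1
    (mul_mem (mul_mem hV hW) (star_mem_specialUnitaryGroup hV))
  have hcol : su2 α β *ᵥ Pi.single 0 (r : ℂ) = u • Pi.single 0 (r : ℂ) := by
    rw [← hD, ← mulVec_mulVec, ← hxV, ← mulVec_mulVec, hx, mulVec_smul, hVx]
  have hβ : β = 0 := by simpa [su2, hr] using congrFun hcol 1
  subst hβ
  obtain ⟨v, hv⟩ := IsAlgClosed.exists_pow_nat_eq α two_pos
  refine ⟨star V, star_mem_specialUnitaryGroup hV, v, ?_, ?_⟩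
  · exact (pow_eq_one_iff_of_nonneg (norm_nonneg v) four_ne_zero).1
      (by simpa [← hv, ← pow_mul] using h)
  · rw [← sq, hv, ← hD]
    calc W = star V * V * W * (star V * V) := by rw [hVV, one_mul, mul_one]
      _ = _ := by simp only [star_star, mul_assoc]

theorem exists_commutator_eq {W : Matrix (Fin 2) (Fin 2) ℂ}
    (hW : W ∈ specialUnitaryGroup (Fin 2) ℂ) :
    ∃ P ∈ specialUnitaryGroup (Fin 2) ℂ, ∃ Q ∈ specialUnitaryGroup (Fin 2) ℂ,
      W = P * Q * star P * star Q := by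
  obtain ⟨V, hV, v, hv, rfl⟩ := exists_specialUnitaryGroup_conj_diagonal hW
  have hVs := star_mem_specialUnitaryGroup hV
  have hVV : star V * V = 1 := Unitary.star_mul_self_of_mem hV.1
  refine ⟨V * su2 v 0 * star V,
    mul_mem (mul_mem hV (su2_zero_mem_specialUnitaryGroup hv)) hVs,
    V * su2 0 1 * star V,
    mul_mem (mul_mem hV su2_zero_one_mem_specialUnitaryGroup) hVs, ?_⟩
  have hcomm : su2 (v * v) 0 = su2 v 0 * su2 0 1 * star (su2 v 0) * star (su2 0 1) := by
    simp [star_su2, su2_mul]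
  rw [hcomm]
  simp only [star_mul, star_star, mul_assoc]
  simp only [← mul_assoc (star V) V, hVV, one_mul]

end SpecialUnitaryTwo

section Rotation

theorem rotationMatrix_eq_su2 (θ φ : ℝ) :
    rotationMatrix θ φ =
      su2 (Real.cos θ) (-Complex.I * Complex.exp (Complex.I * φ) * Real.sin θ) := by
  have hexp : conj (Complex.exp (Complex.I * φ)) = Complex.exp (-Complex.I * φ) := by
    rw [← Complex.exp_conj, map_mul, Complex.conj_I, Complex.conj_ofReal]
  rw [rotationMatrix, su2, map_mul, map_mul, hexp, map_neg, Complex.conj_I, Complex.conj_ofReal,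
    Complex.conj_ofReal]
  simp only [neg_neg, neg_mul]

theorem exists_mem_rotationGates_eq_su2 {c : ℝ} {w : ℂ} (h : c ^ 2 + ‖w‖ ^ 2 = 1) :
    ∃ A ∈ rotationGates, (A : Matrix (Fin 2) (Fin 2) ℂ) = su2 c w := by
  have hperiodic : Function.Periodic (fun φ : ℝ => Complex.exp (Complex.I * φ)) (2 * Real.pi) :=
    fun φ => by simpa [mul_comm] using Complex.exp_mul_I_periodic φ
  obtain ⟨φ, hφ, hexp⟩ :=
    hperiodic.exists_mem_Ico₀ Real.two_pi_pos (Complex.arg (Complex.I * w))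
  have hcos : Real.cos (Real.arccos c) = c :=
    Real.cos_arccos (by nlinarith [sq_nonneg ‖w‖]) (by nlinarith [sq_nonneg ‖w‖])
  have hsin : Real.sin (Real.arccos c) = ‖w‖ := by
    rw [Real.sin_arccos, ← h, add_sub_cancel_left, Real.sqrt_sq (norm_nonneg w)]
  have hw : ‖w‖ * Complex.exp (Complex.I * φ) = Complex.I * w := by
    rw [← hexp, mul_comm Complex.I (Complex.arg _ : ℂ)]
    simpa using Complex.norm_mul_exp_arg_mul_I (Complex.I * w)
  refine ⟨rotationGate (Real.arccos c) φ, ⟨Real.arccos c, ⟨Real.arccos_nonneg c, ?_⟩, φ,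
    Set.Ico_subset_Icc_self hφ, rfl⟩, ?_⟩
  · linarith [Real.arccos_le_pi c, Real.pi_pos]
  · refine (rotationMatrix_eq_su2 _ _).trans ?_
    rw [hcos, hsin]
    congr 1
    linear_combination -Complex.I * hw - w * Complex.I_mul_I

theorem specialUnitaryGroup_le_closure_rotationGates :
    specialUnitaryGroup (Fin 2) ℂ ≤ Submonoid.closure (Subtype.val '' rotationGates) := by
  intro W hW
  have hmem {c : ℝ} {w : ℂ} (h : c ^ 2 + ‖w‖ ^ 2 = 1) :
      su2 c w ∈ Submonoid.closure (Subtype.val '' rotationGates) :=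
    Submonoid.subset_closure (exists_mem_rotationGates_eq_su2 h)
  obtain ⟨α, β, h, rfl⟩ := mem_specialUnitaryGroup_fin_two_iff.1 hW
  set u := Complex.exp (Complex.arg α * Complex.I)
  have hu : ‖u‖ = 1 := Complex.norm_exp_ofReal_mul_I _
  have hα : ‖α‖ * u = α := Complex.norm_mul_exp_arg_mul_I α
  have hfactor : su2 α β = su2 (0 : ℝ) 1 * su2 (0 : ℝ) (-u) * su2 ‖α‖ (u * β) := by
    rw [su2_mul, su2_mul]
    congr 1
    · simp [mul_comm u, hα]
    · simp only [Complex.ofReal_zero, mul_zero, zero_mul, map_zero, map_one, one_mul,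
        zero_sub, add_zero, zero_add, neg_neg]
      linear_combination -β * mul_conj_eq_one hu
  rw [hfactor]
  exact mul_mem (mul_mem (hmem (by simp)) (hmem (by simp [hu]))) (hmem (by simpa [hu] using h))

end Rotation

section CoordInclusion

variable {ι κ R : Type*} [DecidableEq ι] [Semiring R]

/-- The matrix whose columns are the standard basis vectors `e k`; for injective `e`, the isometry
embedding the span of the coordinates `e k`. -/
def coordInclusion (R : Type*) [Semiring R] (e : κ → ι) : Matrix ι κ R :=
  (1 : Matrix ι ι R).submatrix id e

theorem coordInclusion_apply (e : κ → ι) (i : ι) (k : κ) :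
    coordInclusion R e i k = if i = e k then 1 else 0 :=
  one_apply

theorem coordInclusion_mulVec_of_notMem_range [Fintype κ] {e : κ → ι} {i : ι}
    (hi : i ∉ Set.range e) (u : κ → R) : (coordInclusion R e *ᵥ u) i = 0 := by
  have hentry (k : κ) : coordInclusion R e i k = 0 := by
    rw [coordInclusion_apply, if_neg fun h => hi ⟨k, h.symm⟩]
  simp [mulVec, dotProduct, hentry]

variable [Fintype ι]

theorem mul_coordInclusion {l : Type*} (M : Matrix l ι R) (e : κ → ι) :
    M * coordInclusion R e = M.submatrix id e :=
  mul_submatrix_one (Equiv.refl ι) e M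

theorem conjTranspose_coordInclusion_mulVec [StarRing R] (e : κ → ι) (v : ι → R) :
    (coordInclusion R e)ᴴ *ᵥ v = v ∘ e := by
  ext k
  simp [coordInclusion_apply, mulVec, dotProduct, apply_ite star]

theorem conjTranspose_coordInclusion_mul_self [StarRing R] [DecidableEq κ] {e : κ → ι}
    (he : e.Injective) : (coordInclusion R e)ᴴ * coordInclusion R e = 1 := by
  rw [mul_coordInclusion, coordInclusion, conjTranspose_submatrix, conjTranspose_one,
    submatrix_submatrix]
  exact submatrix_one e he

end CoordInclusion

section ExtendAlong

variable {ι κ R : Type*} [CommRing R] [StarRing R] [DecidableEq ι] [Fintype κ] [DecidableEq κ]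

/-- The operator acting as `W` on the range of the isometry `P`, in the orthonormal basis given by
the columns of `P`, and trivially on its orthogonal complement. Unlike a block matrix, this form
turns conjugation by a unitary into multiplication of `P`. -/
def extendAlong (P : Matrix ι κ R) (W : Matrix κ κ R) : Matrix ι ι R :=
  1 + P * (W - 1) * Pᴴ

theorem extendAlong_one (P : Matrix ι κ R) : extendAlong P 1 = 1 := by
  simp [extendAlong]

theorem star_extendAlong (P : Matrix ι κ R) (W : Matrix κ κ R) :
    star (extendAlong P W) = extendAlong P (star W) := by
  simp [extendAlong, star_eq_conjTranspose, Matrix.mul_assoc]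

theorem extendAlong_mul_right {D : Matrix κ κ R} (hD : D ∈ unitaryGroup κ R) (P : Matrix ι κ R)
    (W : Matrix κ κ R) : extendAlong (P * D) W = extendAlong P (D * W * star D) := by
  have hconj : D * W * star D - 1 = D * (W - 1) * star D := by
    rw [mul_sub, sub_mul, mul_one, Unitary.mul_star_self_of_mem hD]
  rw [extendAlong, extendAlong, hconj, conjTranspose_mul, star_eq_conjTranspose]
  simp only [Matrix.mul_assoc]

variable [Fintype ι]

theorem extendAlong_mul_left {U : Matrix ι ι R} (hU : U ∈ unitaryGroup ι R) (P : Matrix ι κ R)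
    (W : Matrix κ κ R) : extendAlong (U * P) W = U * extendAlong P W * star U := by
  rw [extendAlong, extendAlong, mul_add, add_mul, mul_one, Unitary.mul_star_self_of_mem hU,
    conjTranspose_mul, star_eq_conjTranspose]
  simp only [Matrix.mul_assoc]

theorem extendAlong_mul {P : Matrix ι κ R} (hP : Pᴴ * P = 1) (W W' : Matrix κ κ R) :
    extendAlong P (W * W') = extendAlong P W * extendAlong P W' := by
  have hcross : P * (W - 1) * Pᴴ * (P * (W' - 1) * Pᴴ) = P * ((W - 1) * (W' - 1)) * Pᴴ := by
    calc _ = P * (W - 1) * (Pᴴ * P) * (W' - 1) * Pᴴ := by simp only [Matrix.mul_assoc]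
      _ = _ := by rw [hP, Matrix.mul_one]; simp only [Matrix.mul_assoc]
  have hsplit : W * W' - 1 = (W - 1) + (W' - 1) + (W - 1) * (W' - 1) := by noncomm_ring
  rw [extendAlong, extendAlong, extendAlong, hsplit, add_mul 1 (P * (W - 1) * Pᴴ),
    mul_add (P * (W - 1) * Pᴴ), hcross, one_mul, mul_one, Matrix.mul_add, Matrix.mul_add,
    Matrix.add_mul, Matrix.add_mul]
  abel

theorem extendAlong_mem_specialUnitaryGroup {P : Matrix ι κ R} (hP : Pᴴ * P = 1)
    {W : Matrix κ κ R} (hW : W ∈ specialUnitaryGroup κ R) :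
    extendAlong P W ∈ specialUnitaryGroup ι R := by
  refine mem_specialUnitaryGroup_iff.2 ⟨?_, ?_⟩
  · rw [mem_unitaryGroup_iff, star_extendAlong, ← extendAlong_mul hP,
      Unitary.mul_star_self_of_mem hW.1, extendAlong_one]
  · rw [extendAlong, Matrix.mul_assoc, det_one_add_mul_comm, Matrix.mul_assoc, hP, Matrix.mul_one,
      add_sub_cancel, (mem_specialUnitaryGroup_iff.1 hW).2]

theorem extendAlong_coordInclusion_mulVec_apply {e : κ → ι} (he : e.Injective) (W : Matrix κ κ R)
    (v : ι → R) (k : κ) : (extendAlong (coordInclusion R e) W *ᵥ v) (e k) = (W *ᵥ (v ∘ e)) k := by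
  have hP := conjTranspose_coordInclusion_mul_self (R := R) he
  change ((extendAlong (coordInclusion R e) W *ᵥ v) ∘ e) k = _
  rw [← conjTranspose_coordInclusion_mulVec, ← conjTranspose_coordInclusion_mulVec, mulVec_mulVec,
    mulVec_mulVec, extendAlong, Matrix.mul_add, Matrix.mul_one, ← Matrix.mul_assoc,
    ← Matrix.mul_assoc, hP, Matrix.one_mul, Matrix.sub_mul, Matrix.one_mul, add_sub_cancel]

theorem extendAlong_coordInclusion_mulVec_of_notMem_range {e : κ → ι} {i : ι}
    (hi : i ∉ Set.range e) (W : Matrix κ κ R) (v : ι → R) :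
    (extendAlong (coordInclusion R e) W *ᵥ v) i = v i := by
  rw [extendAlong, add_mulVec, one_mulVec, Matrix.mul_assoc, ← mulVec_mulVec, Pi.add_apply,
    coordInclusion_mulVec_of_notMem_range hi, add_zero]

end ExtendAlong

section TwoLevel

variable {ι : Type*} [Fintype ι] [DecidableEq ι]

/-- The operators that leave every coordinate outside `s` of every vector unchanged. -/
def actingWithin (s : Finset ι) : Submonoid (Matrix ι ι ℂ) where
  carrier := {M | ∀ i ∉ s, ∀ v, (M *ᵥ v) i = v i}
  one_mem' i _ v := by rw [one_mulVec]
  mul_mem' hM hN i hi v := by rw [← mulVec_mulVec, hM i hi, hN i hi]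

/-- The operators generated by the two-level special unitaries with levels in `s`, that is, by
those acting as an element of `SU(2)` on two basis vectors indexed by `s`. -/
def twoLevelSubmonoid (s : Finset ι) : Submonoid (Matrix ι ι ℂ) :=
  Submonoid.closure {M | ∃ a ∈ s, ∃ b ∈ s, a ≠ b ∧ ∃ W ∈ specialUnitaryGroup (Fin 2) ℂ,
    M = extendAlong (coordInclusion ℂ ![a, b]) W}

theorem twoLevelSubmonoid_mono {s t : Finset ι} (hst : s ⊆ t) :
    twoLevelSubmonoid s ≤ twoLevelSubmonoid t :=
  Submonoid.closure_mono fun _ ⟨a, ha, b, hb, h⟩ => ⟨a, hst ha, b, hst hb, h⟩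

theorem twoLevelSubmonoid_le_specialUnitaryGroup (s : Finset ι) :
    twoLevelSubmonoid s ≤ specialUnitaryGroup ι ℂ := by
  rw [twoLevelSubmonoid, Submonoid.closure_le]
  rintro _ ⟨a, -, b, -, hab, W, hW, rfl⟩
  exact extendAlong_mem_specialUnitaryGroup
    (conjTranspose_coordInclusion_mul_self (injective_pair_iff_ne.2 hab)) hW

theorem twoLevelSubmonoid_le_actingWithin (s : Finset ι) :
    twoLevelSubmonoid s ≤ actingWithin s := by
  rw [twoLevelSubmonoid, Submonoid.closure_le]
  rintro _ ⟨a, ha, b, hb, -, W, -, rfl⟩ i hi v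
  refine extendAlong_coordInclusion_mulVec_of_notMem_range ?_ W v
  rintro ⟨k, rfl⟩
  fin_cases k <;> contradiction

theorem star_mem_twoLevelSubmonoid {s : Finset ι} {g : Matrix ι ι ℂ}
    (hg : g ∈ twoLevelSubmonoid s) : star g ∈ twoLevelSubmonoid s := by
  induction hg using Submonoid.closure_induction with
  | mem _ h =>
    obtain ⟨a, ha, b, hb, hab, W, hW, rfl⟩ := h
    exact Submonoid.subset_closure
      ⟨a, ha, b, hb, hab, star W, star_mem_specialUnitaryGroup hW, star_extendAlong _ W⟩
  | one => simp
  | mul _ _ _ _ hg hh => rw [star_mul]; exact mul_mem hh hg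

theorem exists_mulVec_eq_zero_right {a b : ι} (hab : a ≠ b) (v : ι → ℂ) :
    ∃ g ∈ twoLevelSubmonoid {a, b}, ∃ r : ℝ, 0 ≤ r ∧ (g *ᵥ v) a = r ∧ (g *ᵥ v) b = 0 := by
  obtain ⟨W, hW, r, hr, hWv⟩ := exists_specialUnitaryGroup_mulVec_eq_single (v ∘ ![a, b])
  have happly (k : Fin 2) : (extendAlong (coordInclusion ℂ ![a, b]) W *ᵥ v) (![a, b] k) =
      Pi.single (M := fun _ => ℂ) 0 (r : ℂ) k := by
    rw [extendAlong_coordInclusion_mulVec_apply (injective_pair_iff_ne.2 hab), hWv]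
  exact ⟨_, Submonoid.subset_closure ⟨a, by simp, b, by simp, hab, W, hW, rfl⟩, r, hr,
    happly 0, happly 1⟩

theorem exists_mulVec_eq_zero_on {a : ι} {t : Finset ι} (ht : t.Nonempty) (hat : a ∉ t)
    (v : ι → ℂ) : ∃ g ∈ twoLevelSubmonoid (insert a t),
      ∃ r : ℝ, 0 ≤ r ∧ (g *ᵥ v) a = r ∧ ∀ i ∈ t, (g *ᵥ v) i = 0 := by
  induction ht using Finset.Nonempty.cons_induction with
  | singleton b => simpa using exists_mulVec_eq_zero_right (Finset.notMem_singleton.1 hat) v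
  | cons b t hbt _ ih =>
    rw [Finset.mem_cons, not_or] at hat
    obtain ⟨g, hg, -, -, -, hzero⟩ := ih hat.2
    obtain ⟨h, hh, r, hr, hha, hhb⟩ := exists_mulVec_eq_zero_right hat.1 (g *ᵥ v)
    have hfix (i : ι) (hi : i ∈ t) : i ∉ ({a, b} : Finset ι) := by
      rw [Finset.mem_insert, Finset.mem_singleton]
      rintro (rfl | rfl)
      exacts [hat.2 hi, hbt hi]
    rw [Finset.cons_eq_insert]
    refine ⟨h * g, mul_mem (twoLevelSubmonoid_mono ?_ hh) (twoLevelSubmonoid_mono ?_ hg),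
      r, hr, ?_, ?_⟩
    · exact Finset.insert_subset_insert a (by simp)
    · exact Finset.insert_subset_insert a (Finset.subset_insert b t)
    · rwa [← mulVec_mulVec]
    · intro i hi
      rw [← mulVec_mulVec]
      rcases Finset.mem_insert.1 hi with rfl | hi
      · exact hhb
      · rw [twoLevelSubmonoid_le_actingWithin _ hh i (hfix i hi), hzero i hi]

theorem star_mulVec_dotProduct_mulVec {U : Matrix ι ι ℂ} (hU : U ∈ unitaryGroup ι ℂ)
    (v w : ι → ℂ) : star (U *ᵥ v) ⬝ᵥ (U *ᵥ w) = star v ⬝ᵥ w := by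
  rw [star_mulVec, ← dotProduct_mulVec, mulVec_mulVec, ← star_eq_conjTranspose,
    Unitary.star_mul_self_of_mem hU, one_mulVec]

theorem exists_mulVec_eq_single {a : ι} {t : Finset ι} (ht : t.Nonempty) (hat : a ∉ t)
    {v : ι → ℂ} (hv : star v ⬝ᵥ v = 1) (hsupp : ∀ i ∉ insert a t, v i = 0) :
    ∃ g ∈ twoLevelSubmonoid (insert a t), g *ᵥ v = Pi.single a 1 := by
  obtain ⟨g, hg, r, hr, hga, hgt⟩ := exists_mulVec_eq_zero_on ht hat v
  have hgv : g *ᵥ v = Pi.single a (r : ℂ) := by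
    ext i
    rcases eq_or_ne i a with rfl | hia
    · rw [hga, Pi.single_eq_same]
    · rw [Pi.single_eq_of_ne hia]
      by_cases hi : i ∈ t
      · exact hgt i hi
      · have hi' : i ∉ insert a t := by simp [hia, hi]
        rw [twoLevelSubmonoid_le_actingWithin _ hg i hi', hsupp i hi']
  have hr1 : r = 1 := by
    have hnorm := star_mulVec_dotProduct_mulVec
      (twoLevelSubmonoid_le_specialUnitaryGroup _ hg).1 v v
    rw [hv, hgv, dotProduct_single, Pi.star_apply, Pi.single_eq_same] at hnorm
    have hrr : r * r = 1 := by exact_mod_cast (by simpa using hnorm : (r : ℂ) * r = 1)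
    nlinarith
  exact ⟨g, hg, by rw [hgv, hr1, Complex.ofReal_one]⟩

theorem mulVec_apply_of_mulVec_single {U : Matrix ι ι ℂ} (hU : U ∈ unitaryGroup ι ℂ) {a : ι}
    (ha : U *ᵥ Pi.single a 1 = Pi.single a 1) (w : ι → ℂ) : (U *ᵥ w) a = w a := by
  simpa [ha] using star_mulVec_dotProduct_mulVec hU (Pi.single a 1) w

theorem apply_of_mem_actingWithin {s : Finset ι} {V : Matrix ι ι ℂ} (hV : V ∈ actingWithin s)
    {i : ι} (hi : i ∉ s) : V i = (1 : Matrix ι ι ℂ) i := by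
  ext j
  simpa [Pi.single_apply, one_apply] using hV i hi (Pi.single j 1)

theorem det_of_mem_actingWithin_singleton {a : ι} {V : Matrix ι ι ℂ} (hV : V ∈ actingWithin {a}) :
    V.det = V a a := by
  have hrow : V = (1 : Matrix ι ι ℂ).updateRow a (V a) := by
    ext i
    rcases eq_or_ne i a with rfl | hia
    · rw [updateRow_self]
    · rw [updateRow_ne hia, apply_of_mem_actingWithin hV (by simpa using hia)]
  calc V.det = cramer (1 : Matrix ι ι ℂ)ᵀ (V a) a := by rw [cramer_transpose_apply, ← hrow]
    _ = V a a := by rw [transpose_one, cramer_one]; rfl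

theorem exists_mul_mulVec_single {a : ι} {t : Finset ι} (hat : a ∉ t) {V : Matrix ι ι ℂ}
    (hV : V ∈ specialUnitaryGroup ι ℂ) (hVact : V ∈ actingWithin (insert a t)) :
    ∃ g ∈ twoLevelSubmonoid (insert a t), (g * V) *ᵥ Pi.single a 1 = Pi.single a 1 := by
  have hsupp (i : ι) (hi : i ∉ insert a t) : (V *ᵥ Pi.single a 1) i = 0 := by
    rw [hVact i hi, Pi.single_eq_of_ne (by rintro rfl; simp at hi)]
  rcases t.eq_empty_or_nonempty with rfl | ht
  · refine ⟨1, one_mem _, ?_⟩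
    have hdiag : V a a = 1 :=
      (det_of_mem_actingWithin_singleton hVact).symm.trans (mem_specialUnitaryGroup_iff.1 hV).2
    ext i
    rw [one_mul]
    rcases eq_or_ne i a with rfl | hia
    · simp [hdiag]
    · rw [hsupp i (by simpa using hia), Pi.single_eq_of_ne hia]
  · have hunit : star (V *ᵥ Pi.single a 1) ⬝ᵥ (V *ᵥ Pi.single a 1) = 1 := by
      rw [star_mulVec_dotProduct_mulVec hV.1]
      simp
    simpa only [mulVec_mulVec] using exists_mulVec_eq_single ht hat hunit hsupp

theorem mem_twoLevelSubmonoid {s : Finset ι} {V : Matrix ι ι ℂ}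
    (hV : V ∈ specialUnitaryGroup ι ℂ) (hVact : V ∈ actingWithin s) :
    V ∈ twoLevelSubmonoid s := by
  induction s using Finset.induction_on generalizing V with
  | empty =>
    have hone : V = 1 := Matrix.ext fun i =>
      congrFun (apply_of_mem_actingWithin hVact (Finset.notMem_empty i))
    exact hone ▸ one_mem _
  | insert a t hat ih =>
    obtain ⟨g, hg, hgVa⟩ := exists_mul_mulVec_single hat hV hVact
    have hgS := twoLevelSubmonoid_le_specialUnitaryGroup _ hg
    have hgV : g * V ∈ specialUnitaryGroup ι ℂ := mul_mem hgS hV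
    have hgVact : g * V ∈ actingWithin t := by
      intro i hi w
      rcases eq_or_ne i a with rfl | hia
      · exact mulVec_apply_of_mulVec_single hgV.1 hgVa w
      · exact mul_mem (twoLevelSubmonoid_le_actingWithin _ hg) hVact i (by simp [hia, hi]) w
    have hfactor : V = star g * (g * V) := by
      rw [← mul_assoc, Unitary.star_mul_self_of_mem hgS.1, one_mul]
    rw [hfactor]
    exact mul_mem (star_mem_twoLevelSubmonoid hg)
      (twoLevelSubmonoid_mono (Finset.subset_insert a t) (ih hgV hgVact))

theorem specialUnitaryGroup_le_twoLevelSubmonoid_univ :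
    specialUnitaryGroup ι ℂ ≤ twoLevelSubmonoid Finset.univ :=
  fun _ hV => mem_twoLevelSubmonoid hV fun i hi => absurd (Finset.mem_univ i) hi

end TwoLevel

section Linked

theorem conj_mem_specialUnitaryGroup {κ R : Type*} [Fintype κ] [DecidableEq κ] [CommRing R]
    [StarRing R] {D W : Matrix κ κ R} (hD : D ∈ unitaryGroup κ R)
    (hW : W ∈ specialUnitaryGroup κ R) : D * W * star D ∈ specialUnitaryGroup κ R := by
  refine mem_specialUnitaryGroup_iff.2 ⟨mul_mem (mul_mem hD hW.1) (Unitary.star_mem hD), ?_⟩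
  rw [det_mul_right_comm, Unitary.mul_star_self_of_mem hD, one_mul,
    (mem_specialUnitaryGroup_iff.1 hW).2]

theorem pauliX_eq_coordInclusion : pauliX = coordInclusion ℂ ![1, 0] := by
  ext i j
  fin_cases i <;> fin_cases j <;> simp [pauliX, coordInclusion_apply]

theorem pauliX_mem_unitaryGroup : pauliX ∈ unitaryGroup (Fin 2) ℂ := by
  rw [mem_unitaryGroup_iff', pauliX_eq_coordInclusion]
  exact conjTranspose_coordInclusion_mul_self (by decide)

variable {ι : Type*} [Fintype ι] [DecidableEq ι] {G : Submonoid (Matrix ι ι ℂ)}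

/-- Either `a = b`, or `G` contains the whole of `SU(2)` acting on the basis vectors `a` and `b`.
With the degenerate case included, this is an equivalence relation. -/
def TwoLevelLinked (G : Submonoid (Matrix ι ι ℂ)) (a b : ι) : Prop :=
  a ≠ b → ∀ W ∈ specialUnitaryGroup (Fin 2) ℂ, extendAlong (coordInclusion ℂ ![a, b]) W ∈ G

theorem TwoLevelLinked.refl (a : ι) : TwoLevelLinked G a a :=
  fun h => absurd rfl h

theorem TwoLevelLinked.symm {a b : ι} (h : TwoLevelLinked G a b) : TwoLevelLinked G b a := by
  intro hba W hW
  have hswap : coordInclusion ℂ ![b, a] = coordInclusion ℂ ![a, b] * pauliX := by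
    rw [pauliX_eq_coordInclusion, mul_coordInclusion, coordInclusion, coordInclusion,
      submatrix_submatrix]
    congr 1
    ext k
    fin_cases k <;> rfl
  rw [hswap, extendAlong_mul_right pauliX_mem_unitaryGroup]
  exact h hba.symm _ (conj_mem_specialUnitaryGroup pauliX_mem_unitaryGroup hW)

theorem extendAlong_su2_zero_one_mul_coordInclusion {a b c : ι} (hab : a ≠ b) (hac : a ≠ c)
    (hbc : b ≠ c) : extendAlong (coordInclusion ℂ ![b, c]) (su2 0 1) * coordInclusion ℂ ![a, b] =
      coordInclusion ℂ ![a, c] := by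
  ext i k
  change (extendAlong (coordInclusion ℂ ![b, c]) (su2 0 1) *ᵥ
    fun j => coordInclusion ℂ ![a, b] j k) i = _
  by_cases hi : i ∈ Set.range ![b, c]
  · obtain ⟨l, rfl⟩ := hi
    rw [extendAlong_coordInclusion_mulVec_apply (injective_pair_iff_ne.2 hbc)]
    fin_cases k <;> fin_cases l <;>
      simp [coordInclusion_apply, su2, mulVec, dotProduct, hab.symm, hac.symm, hbc, hbc.symm]
  · rw [extendAlong_coordInclusion_mulVec_of_notMem_range hi]
    fin_cases k
    · rfl
    · have hib : i ≠ b := fun h => hi ⟨0, h.symm⟩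
      have hic : i ≠ c := fun h => hi ⟨1, h.symm⟩
      simp [coordInclusion_apply, hib, hic]

theorem TwoLevelLinked.trans {a b c : ι} (h : TwoLevelLinked G a b) (h' : TwoLevelLinked G b c) :
    TwoLevelLinked G a c := by
  rcases eq_or_ne a b with rfl | hab
  · exact h'
  rcases eq_or_ne b c with rfl | hbc
  · exact h
  intro hac W hW
  have hJ := su2_zero_one_mem_specialUnitaryGroup
  have hU := (extendAlong_mem_specialUnitaryGroup
    (conjTranspose_coordInclusion_mul_self (injective_pair_iff_ne.2 hbc)) hJ).1
  rw [← extendAlong_su2_zero_one_mul_coordInclusion hab hac hbc, extendAlong_mul_left hU,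
    star_extendAlong]
  exact mul_mem (mul_mem (h' hbc _ hJ) (h hab W hW)) (h' hbc _ (star_mem_specialUnitaryGroup hJ))

theorem specialUnitaryGroup_le_of_twoLevelLinked (hG : ∀ a b, TwoLevelLinked G a b) :
    specialUnitaryGroup ι ℂ ≤ G := by
  refine specialUnitaryGroup_le_twoLevelSubmonoid_univ.trans ?_
  rw [twoLevelSubmonoid, Submonoid.closure_le]
  rintro _ ⟨a, -, b, -, hab, W, hW, rfl⟩
  exact hG a b hab W hW

end Linked

section Controlled

variable {X : Type*}

/-- The family of operators that is `W` on `s` and trivial off `s`: the operator `W` controlled by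
the condition `x ∈ s`, where `x` is the state of the control qubits. -/
noncomputable def controlledHom {M : Type*} [Monoid M] (s : Set X) : M →* (X → M) :=
  (Set.mulIndicatorHom M s).comp (Pi.constMonoidHom X M)

theorem controlledHom_apply {M : Type*} [Monoid M] (s : Set X) (W : M) (x : X)
    [Decidable (x ∈ s)] : controlledHom s W x = if x ∈ s then W else 1 :=
  Set.mulIndicator_apply s _ x

/-- Every special unitary operator on one qubit, controlled by `s`, lies in `Γ`. -/
def Controls (Γ : Submonoid (X → Matrix (Fin 2) (Fin 2) ℂ)) (s : Set X) : Prop :=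
  specialUnitaryGroup (Fin 2) ℂ ≤ Γ.comap (controlledHom s)

variable {Γ : Submonoid (X → Matrix (Fin 2) (Fin 2) ℂ)} {s t : Set X}

theorem pauliX_mul_su2_mul_pauliX (α β : ℂ) :
    pauliX * su2 α β * pauliX = su2 (conj α) (-conj β) := by
  ext i j
  fin_cases i <;> fin_cases j <;> simp [su2, pauliX, Matrix.mul_apply]

theorem Controls.of_controlledHom_pauliX_mem (huniv : Controls Γ Set.univ)
    (hX : controlledHom s pauliX ∈ Γ) : Controls Γ s := by
  intro W hW
  obtain ⟨V, hV, v, hv, rfl⟩ := exists_specialUnitaryGroup_conj_diagonal hW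
  have hE := su2_zero_mem_specialUnitaryGroup hv
  have hVV : V * star V = 1 := Unitary.mul_star_self_of_mem hV.1
  have hEE : su2 v 0 * star (su2 v 0) = 1 := Unitary.mul_star_self_of_mem hE.1
  -- `σ_x` inverts the diagonal matrix `E`, so `E σ_x E⁻¹ σ_x = E²`, while `E E⁻¹ = 1` off `s`.
  have hEXEX : su2 (v * v) 0 = su2 v 0 * (pauliX * star (su2 v 0) * pauliX) := by
    simp [star_su2, pauliX_mul_su2_mul_pauliX, su2_mul]
  have hfactor : controlledHom s (V * su2 (v * v) 0 * star V) =
      controlledHom Set.univ (V * su2 v 0) * controlledHom s pauliX *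
        controlledHom Set.univ (star (su2 v 0)) * controlledHom s pauliX *
        controlledHom Set.univ (star V) := by
    ext x : 1
    classical
    simp only [Pi.mul_apply, controlledHom_apply, Set.mem_univ, if_true]
    split_ifs
    · simp only [hEXEX, mul_assoc]
    · simp only [mul_one, mul_assoc V, hEE, hVV]
  rw [Submonoid.mem_comap, hfactor]
  exact mul_mem (mul_mem (mul_mem (mul_mem (huniv (mul_mem hV hE)) hX)
    (huniv (star_mem_specialUnitaryGroup hE))) hX) (huniv (star_mem_specialUnitaryGroup hV))

theorem Controls.compl (huniv : Controls Γ Set.univ) (hs : Controls Γ s) : Controls Γ sᶜ := by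
  intro W hW
  have hWW : W * star W = 1 := Unitary.mul_star_self_of_mem hW.1
  have hfactor : controlledHom sᶜ W = controlledHom Set.univ W * controlledHom s (star W) := by
    ext x : 1
    classical
    by_cases hx : x ∈ s <;> simp [controlledHom_apply, hx, hWW]
  rw [Submonoid.mem_comap, hfactor]
  exact mul_mem (huniv hW) (hs (star_mem_specialUnitaryGroup hW))

theorem Controls.inter (hs : Controls Γ s) (ht : Controls Γ t) : Controls Γ (s ∩ t) := by
  intro W hW
  -- The commutator of two operators is trivial wherever one of the factors is.
  obtain ⟨P, hP, Q, hQ, rfl⟩ := exists_commutator_eq hW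
  have hPP : P * star P = 1 := Unitary.mul_star_self_of_mem hP.1
  have hQQ : Q * star Q = 1 := Unitary.mul_star_self_of_mem hQ.1
  have hfactor : controlledHom (s ∩ t) (P * Q * star P * star Q) =
      controlledHom s P * controlledHom t Q * controlledHom s (star P) *
        controlledHom t (star Q) := by
    ext x : 1
    classical
    by_cases hx : x ∈ s <;> by_cases hx' : x ∈ t <;>
      simp [controlledHom_apply, -map_mul, hx, hx', hPP, hQQ]
  rw [Submonoid.mem_comap, hfactor]
  exact mul_mem (mul_mem (mul_mem (hs hP) (ht hQ)) (hs (star_mem_specialUnitaryGroup hP)))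
    (ht (star_mem_specialUnitaryGroup hQ))

theorem Controls.biInter {κ : Type*} (huniv : Controls Γ Set.univ) {A : κ → Set X}
    (hA : ∀ c, Controls Γ (A c)) (u : Finset κ) : Controls Γ (⋂ c ∈ u, A c) := by
  classical
  induction u using Finset.induction_on with
  | empty => simpa using huniv
  | insert c u _ ih =>
    rw [Finset.set_biInter_insert]
    exact (hA c).inter ih

theorem Controls.singleton {κ : Type*} [Finite κ]
    {Γ : Submonoid ((κ → Fin 2) → Matrix (Fin 2) (Fin 2) ℂ)} (huniv : Controls Γ Set.univ)
    (hX : ∀ c, controlledHom {x : κ → Fin 2 | x c = 1} pauliX ∈ Γ) (a : κ → Fin 2) :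
    Controls Γ {a} := by
  have := Fintype.ofFinite κ
  have hone (c : κ) : Controls Γ {x : κ → Fin 2 | x c = 1} :=
    huniv.of_controlledHom_pauliX_mem (hX c)
  have hbit (c : κ) : Controls Γ {x : κ → Fin 2 | x c = a c} := by
    rcases (by omega : a c = 0 ∨ a c = 1) with h | h
    · have hcompl : {x : κ → Fin 2 | x c = 0} = {x : κ → Fin 2 | x c = 1}ᶜ := by
        ext x
        simp only [Set.mem_ofPred_eq, Set.mem_compl_iff]
        omega
      rw [h, hcompl]
      exact huniv.compl (hone c)
    · rw [h]
      exact hone c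
  have hsingleton : {a} = ⋂ c ∈ Finset.univ, {x : κ → Fin 2 | x c = a c} := by
    ext x
    simp [funext_iff]
  rw [hsingleton]
  exact huniv.biInter hbit _

end Controlled

section Slot

variable {κ : Type*} [Fintype κ] [DecidableEq κ]

/-- The operator acting on the qubit in slot `t` by `F x`, where `x` is the state of the qubits in
the other slots. -/
def slotHom (t : κ) :
    (({i // i ≠ t} → Fin 2) → Matrix (Fin 2) (Fin 2) ℂ) →*
      Matrix (κ → Fin 2) (κ → Fin 2) ℂ where
  toFun F := (blockDiagonal F).submatrix (Equiv.funSplitAt t (Fin 2)) (Equiv.funSplitAt t (Fin 2))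
  map_one' := by rw [blockDiagonal_one, submatrix_one_equiv]
  map_mul' F F' := by
    rw [submatrix_mul_equiv, ← blockDiagonal_mul]
    rfl

theorem slotHom_apply (t : κ) (F : ({i // i ≠ t} → Fin 2) → Matrix (Fin 2) (Fin 2) ℂ)
    (x y : κ → Fin 2) :
    slotHom t F x y = if ∀ i, i ≠ t → x i = y i then F (fun i => x i) (x t) (y t) else 0 := by
  change blockDiagonal F (Equiv.funSplitAt t (Fin 2) x) (Equiv.funSplitAt t (Fin 2) y) = _
  simp [blockDiagonal_apply, funext_iff]

theorem slotHom_mulVec (t : κ) (F : ({i // i ≠ t} → Fin 2) → Matrix (Fin 2) (Fin 2) ℂ)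
    (v : (κ → Fin 2) → ℂ) (x : κ → Fin 2) :
    (slotHom t F *ᵥ v) x = (F (fun i => x i) *ᵥ fun k => v (Function.update x t k)) (x t) := by
  have hupdate (k : Fin 2) : (Equiv.funSplitAt t (Fin 2)).symm (k, fun i => x i) =
      Function.update x t k := by
    ext i
    rcases eq_or_ne i t with rfl | hi <;> simp [*]
  change ((blockDiagonal F).submatrix (Equiv.funSplitAt t (Fin 2)) (Equiv.funSplitAt t (Fin 2))
    *ᵥ v) x = _
  rw [submatrix_mulVec_equiv]
  simp [mulVec, dotProduct, Fintype.sum_prod_type, blockDiagonal_apply, hupdate]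

theorem slotHom_controlledHom_singleton (t : κ) (a : κ → Fin 2) (W : Matrix (Fin 2) (Fin 2) ℂ) :
    slotHom t (controlledHom {fun i : {i // i ≠ t} => a i} W) =
      extendAlong (coordInclusion ℂ (Function.update a t)) W := by
  refine Matrix.ext_of_mulVec_single fun y => funext fun x => ?_
  generalize Pi.single (M := fun _ => ℂ) y 1 = v
  rw [slotHom_mulVec, controlledHom_apply]
  split_ifs with hx
  · have hxa : x = Function.update a t (x t) := by
      rw [Function.eq_update_iff]
      exact ⟨rfl, fun i hi => congrFun hx ⟨i, hi⟩⟩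
    have hupdate : Function.update x t = Function.update a t := by
      rw [hxa]
      exact funext fun k => Function.update_idem ..
    conv_rhs => rw [hxa, extendAlong_coordInclusion_mulVec_apply (Function.update_injective a t)]
    rw [hupdate]
    rfl
  · rw [extendAlong_coordInclusion_mulVec_of_notMem_range, one_mulVec, Function.update_eq_self]
    rintro ⟨k, rfl⟩
    exact hx (funext fun i => Function.update_of_ne i.2 k a)

variable {n : ℕ}

theorem onSlot_eq_slotHom (A : OneBitGate) (t : Fin n) :
    A.onSlot t = slotHom t (controlledHom Set.univ (A : Matrix (Fin 2) (Fin 2) ℂ)) := by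
  ext x y
  simp [slotHom_apply, controlledHom_apply, OneBitGate.onSlot]

theorem cnotGate_onSlots_eq_slotHom {c t : Fin n} (h : c ≠ t) :
    cnotGate.onSlots c t = slotHom t (controlledHom {x | x ⟨c, h⟩ = 1} pauliX) := by
  ext x y
  rw [slotHom_apply, controlledHom_apply]
  simp only [TwoBitGate.onSlots, cnotGate, controlledMatrix, of_apply, Set.mem_ofPred_eq]
  by_cases hc : x c = y c
  · have hiff : (∀ i, i ≠ c → i ≠ t → x i = y i) ↔ ∀ i, i ≠ t → x i = y i :=
      ⟨fun H i hi => if hic : i = c then hic ▸ hc else H i hic hi, fun H i _ hi => H i hi⟩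
    simp only [hiff, hc, if_true]
    split_ifs <;> simp_all [Matrix.one_apply]
  · rw [if_neg fun H : ∀ i, i ≠ t → x i = y i => hc (H c h)]
    simp [hc]

end Slot

section Universality

theorem TwoLevelLinked.of_update {κ α : Type*} [Fintype κ] [DecidableEq κ] [Fintype α]
    [DecidableEq α] {G : Submonoid (Matrix (κ → α) (κ → α) ℂ)}
    (hG : ∀ a t k, TwoLevelLinked G a (Function.update a t k)) (a b : κ → α) :
    TwoLevelLinked G a b := by
  have hpath (s : Finset κ) : TwoLevelLinked G a (s.piecewise b a) := by
    induction s using Finset.induction_on with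
    | empty => simpa using TwoLevelLinked.refl a
    | insert t s _ ih =>
      rw [Finset.piecewise_insert]
      exact ih.trans (hG _ _ _)
  simpa using hpath Finset.univ

theorem twoLevelLinked_update {κ : Type*} [Fintype κ] [DecidableEq κ]
    {G : Submonoid (Matrix (κ → Fin 2) (κ → Fin 2) ℂ)} {t : κ}
    (huniv : Controls (G.comap (slotHom t)) Set.univ)
    (hX : ∀ c : {i // i ≠ t}, slotHom t (controlledHom {x | x c = 1} pauliX) ∈ G)
    (a : κ → Fin 2) (k : Fin 2) : TwoLevelLinked G a (Function.update a t k) := by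
  have hflip : TwoLevelLinked G (Function.update a t 0) (Function.update a t 1) := by
    intro _ W hW
    have hpair : ![Function.update a t 0, Function.update a t 1] = Function.update a t := by
      ext j
      fin_cases j <;> rfl
    rw [hpair, ← slotHom_controlledHom_singleton]
    exact Controls.singleton huniv hX _ hW
  have hlink (j : Fin 2) : TwoLevelLinked G (Function.update a t j) (Function.update a t k) := by
    fin_cases j <;> fin_cases k
    exacts [.refl _, hflip, hflip.symm, .refl _]
  simpa only [Function.update_eq_self] using hlink (a t)

theorem specialUnitaryGroup_le_composedOperators {S : Set OneBitGate} {T : Set TwoBitGate}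
    (hS : specialUnitaryGroup (Fin 2) ℂ ≤ Submonoid.closure (Subtype.val '' S))
    (hT : cnotGate ∈ T) (n : ℕ) :
    specialUnitaryGroup (Fin n → Fin 2) ℂ ≤ composedOperators S T n := by
  refine specialUnitaryGroup_le_of_twoLevelLinked <| TwoLevelLinked.of_update fun a t =>
    twoLevelLinked_update (hS.trans ?_) (fun c => ?_) a
  · rw [Submonoid.closure_le]
    rintro _ ⟨A, hA, rfl⟩
    exact Submonoid.subset_closure (Or.inl ⟨A, hA, t, (onSlot_eq_slotHom A t).symm⟩)
  · exact Submonoid.subset_closure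
      (Or.inr ⟨cnotGate, hT, c, t, c.2, (cnotGate_onSlots_eq_slotHom c.2).symm⟩)

end Universality

/-- The rotation gates and the CNOT gate are universal; moreover no phase factor is needed for the
`n`-bit gates of determinant one. -/
theorem corollary2p3 :
    IsUniversalGateSet rotationGates {cnotGate} ∧
      ∀ n : ℕ, 2 ≤ n → ∀ V ∈ Matrix.specialUnitaryGroup (Fin n → Fin 2) ℂ,
        V ∈ composedOperators rotationGates {cnotGate} n := by
  have hSU (n : ℕ) : specialUnitaryGroup (Fin n → Fin 2) ℂ ≤
      composedOperators rotationGates {cnotGate} n :=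
    specialUnitaryGroup_le_composedOperators specialUnitaryGroup_le_closure_rotationGates
      (Set.mem_singleton cnotGate) n
  refine ⟨fun n _ V hV => ?_, fun n _ V hV => hSU n hV⟩
  obtain ⟨c, hc, hcV⟩ := exists_smul_mem_specialUnitaryGroup hV
  exact ⟨c, hc, hSU n hcV⟩
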